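/- **Problem.** An input of Min-cost Perfect Matching with Delays (MPMD) consists of $2m$ requests $u_1,\dots,u_{2m}$ in a metric space $(\mathcal X,\mathrm{dist})$; a request $u$ has a position $\mathrm{pos}(u)\in\mathcal X$, an arrival time $\mathrm{atime}(u)\in\mathbb R$ and a polarity $\mathrm{sgn}(u)$, and $\mathrm{atime}(u_1)\le\dots\le\mathrm{atime}(u_{2m})$. In MPMD all polarities are $0$; in the bipartite variant MBPMD exactly $m$ requests have polarity $+1$ and the other $m$ have polarity $-1$. At any time $\tau$ one may irrevocably match two different, not yet matched requests $u,v$ that have already arrived and satisfy $\mathrm{sgn}(u)=-\mathrm{sgn}(v)$; this costs $\mathrm{dist}(\mathrm{pos}(u),\mathrm{pos}(v))+(\tau-\mathrm{atime}(u))+(\tau-\mathrm{atime}(v))$. All requests have to be matched, and $\mathrm{OPT}(I)$ is the minimum total cost of an offline solution for the input $I$. **Algorithm Greedy Dual (GD).** An edge is a pair of different arrived requests $u,v$ with $\mathrm{sgn}(u)=-\mathrm{sgn}(v)$; its cost is $c(u,v)=\mathrm{dist}(\mathrm{pos}(u),\mathrm{pos}(v))+|\mathrm{atime}(u)-\mathrm{atime}(v)|$.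 GD maintains a partition of the arrived requests into active sets, and a number $y_S$ for every set $S$ of arrived requests. When $u$ arrives, $\{u\}$ becomes an active set and $y_S$ is set to $0$ for all $S\ni u$. While there is an edge $(u,v)$ whose endpoints lie in different active sets and for which $\sum_{S:\,|S\cap\{u,v\}|=1}y_S=c(u,v)$, GD replaces the two active sets containing $u$ and $v$ by their union $S$ and then, as long as $S$ contains two different unmatched requests $u',v'$ with $\mathrm{sgn}(u')=-\mathrm{sgn}(v')$, matches such a pair. When none of these events takes place, $y_S$ increases at unit rate, as time passes, for every active set $S$ that contains an unmatched request. Remaining choices (which pair, which edge, whether an arrival or a simultaneous tight edge is processed first) are made by an arbitrary fixed deterministic rule that depends only on the current state. **Theorem 1.** For every such rule, GD is a deterministic online $(2m+1)$-competitive algorithm for both MPMD and MBPMD, in arbitrary metric spaces that need not be known in advance. That is: (i) on every input $I$ of either variant, with $2m$ requests in any metric space, GD stops after finitely many events with a uniquely determined outcome, all requests are then feasibly matched, and $$\mathrm{GD}(I)\le(2m+1)\cdot\mathrm{OPT}(I);$$ (ii) the edges that GD matches up to any time $\tau$ depend only on the arrival times, the polarities and the mutual distances of the requests that have arrived up to time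 $\tau$ (so neither on $m$ nor on the rest of the input or of the metric space). -/

import Mathlib

universe u v

namespace MPMD

noncomputable section

/-! ### Inputs, feasible solutions and the offline optimum -/

/-- A request: a point of the metric space, an arrival time and a polarity. -/
structure Request (X : Type u) where
  pos : X
  atime : ℝ
  sgn : SignType

/-- An input: `2 * m` requests `req 0, …, req (2 * m - 1)`, listed by arrival time. The values of
`req` at indices `≥ 2 * m` are not part of the input and are never used. -/
structure Input (X : Type u) where
  m : ℕ
  req : ℕ → Request X
  sorted : ∀ i j, i ≤ j → j < 2 * m → (req i).atime ≤ (req j).atime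

/-- A matching edge: the requests `fst` and `snd` are matched with each other at time `time`. -/
structure MatchEdge where
  fst : ℕ
  snd : ℕ
  time : ℝ

namespace Input

variable {X : Type u}

/-- Non-bipartite variant: requests have no polarity, which is encoded by `0`. -/
def IsMPMD (I : Input X) : Prop :=
  ∀ i < 2 * I.m, (I.req i).sgn = 0

/-- Bipartite variant: half of the requests are positive and the other half negative. -/
def IsMBPMD (I : Input X) : Prop :=
  (∀ i < 2 * I.m, (I.req i).sgn = 1 ∨ (I.req i).sgn = -1) ∧
  ((Finset.range (2 * I.m)).filter fun i => (I.req i).sgn = 1).card = I.m ∧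
  ((Finset.range (2 * I.m)).filter fun i => (I.req i).sgn = -1).card = I.m

/-- `M` is a feasible (online or offline) solution: it matches every request exactly once, each
edge joins two different requests of polarities opposite to each other (`0 = -0`), and no edge
is created before both of its endpoints have arrived. -/
def Feasible (I : Input X) (M : Finset MatchEdge) : Prop :=
  (∀ e ∈ M, e.fst < 2 * I.m ∧ e.snd < 2 * I.m ∧ e.fst ≠ e.snd ∧
    (I.req e.fst).sgn = -(I.req e.snd).sgn ∧
    (I.req e.fst).atime ≤ e.time ∧ (I.req e.snd).atime ≤ e.time) ∧
  ∀ i < 2 * I.m, ∃! e, e ∈ M ∧ (e.fst = i ∨ e.snd = i)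

/-- Total cost: connection cost plus the waiting costs of both endpoints, over all edges. -/
def cost [MetricSpace X] (I : Input X) (M : Finset MatchEdge) : ℝ :=
  ∑ e ∈ M, (dist (I.req e.fst).pos (I.req e.snd).pos
    + (e.time - (I.req e.fst).atime) + (e.time - (I.req e.snd).atime))

/-- The cost of an optimal offline solution. -/
def opt [MetricSpace X] (I : Input X) : ℝ :=
  sInf {c | ∃ M, I.Feasible M ∧ I.cost M = c}

end Input

/-- What an online algorithm learns when a request arrives: its arrival time, its polarity, and its
distances `dist 0, dist 1, …` to the requests that came before it. -/
structure Arrival where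
  atime : ℝ
  sgn : SignType
  dist : ℕ → ℝ

/-- The information revealed when request `k` arrives. -/
def Input.arrival {X : Type u} [MetricSpace X] (I : Input X) (k : ℕ) : Arrival where
  atime := (I.req k).atime
  sgn := (I.req k).sgn
  dist j := if j < k then dist (I.req k).pos (I.req j).pos else 0

/-! ### The algorithm Greedy Dual -/

/-- The state of Greedy Dual: the current time, the number of requests that have arrived (these are
the requests `0, …, num - 1`), what has been revealed about them, the assignment `active` of the
current active set to each of them, the dual variables, the marked edges, and the matching edges
created so far. -/
structure State where
  clock : ℝ
  num : ℕ
  info : ℕ → Arrival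
  active : ℕ → Finset ℕ
  y : Finset ℕ → ℝ
  marked : Finset (Sym2 ℕ)
  matching : Finset MatchEdge

namespace State

/-- The state at time `t₀`, before any request. -/
def init (t₀ : ℝ) : State where
  clock := t₀
  num := 0
  info := fun _ => ⟨0, 0, fun _ => 0⟩
  active := fun _ => ∅
  y := fun _ => 0
  marked := ∅
  matching := ∅

/-- Distance between the arrived requests `u` and `v`, as revealed by the later one of them. -/
def rdist (s : State) (u v : ℕ) : ℝ := (s.info (max u v)).dist (min u v)

/-- Cost of the edge `(u, v)`: the cost of matching `u` with `v` as soon as both have arrived. -/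
def edgeCost (s : State) (u v : ℕ) : ℝ :=
  s.rdist u v + |(s.info u).atime - (s.info v).atime|

/-- `(u, v)` is an edge: two different arrived requests that may be matched with each other. -/
def IsEdge (s : State) (u v : ℕ) : Prop :=
  u < s.num ∧ v < s.num ∧ u ≠ v ∧ (s.info u).sgn = -(s.info v).sgn

/-- `u` has arrived and has not been matched yet. -/
def IsFree (s : State) (u : ℕ) : Prop :=
  u < s.num ∧ ∀ e ∈ s.matching, e.fst ≠ u ∧ e.snd ≠ u

/-- `S` is an active set that contains a free request. -/
def IsGrowing (s : State) (S : Finset ℕ) : Prop :=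
  (∃ u < s.num, s.active u = S) ∧ ∃ u ∈ S, s.IsFree u

/-- The left-hand side of the dual constraint of `(u, v)`: the sum of `y S` over all sets `S` of
arrived requests that contain exactly one of `u` and `v`. -/
def load (s : State) (u v : ℕ) : ℝ :=
  ∑ S ∈ (Finset.range s.num).powerset.filter (fun S => ¬(u ∈ S ↔ v ∈ S)), s.y S

/-- The edge `(u, v)` joins two different active sets and its dual constraint is tight. -/
def IsTight (s : State) (u v : ℕ) : Prop :=
  s.IsEdge u v ∧ s.active u ≠ s.active v ∧ s.load u v = s.edgeCost u v

/-- `u` and `v` are free requests of the same active set that can be matched with each other. -/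
def IsMatchable (s : State) (u v : ℕ) : Prop :=
  s.IsEdge u v ∧ s.active u = s.active v ∧ s.IsFree u ∧ s.IsFree v

/-- A request arrives: it becomes a singleton active set and the dual variables of all the sets that
contain it are initialized to `0`. -/
def arrive (s : State) (a : Arrival) : State :=
  { s with
    num := s.num + 1
    info := Function.update s.info s.num a
    active := Function.update s.active s.num {s.num}
    y := fun S => if s.num ∈ S then 0 else s.y S }

/-- Merge the active sets of `u` and `v`, and mark the edge `(u, v)`. -/
def merge (s : State) (u v : ℕ) : State :=
  { s with
    active := fun w =>
      if w ∈ s.active u ∪ s.active v then s.active u ∪ s.active v else s.active w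
    marked := insert s(u, v) s.marked }

open scoped Classical in
/-- Match `u` with `v` now. -/
def pair (s : State) (u v : ℕ) : State :=
  { s with matching := insert ⟨u, v, s.clock⟩ s.matching }

open scoped Classical in
/-- Let `δ` units of time pass: the dual variables of all growing active sets increase at unit rate,
nothing else changes. -/
def grow (s : State) (δ : ℝ) : State :=
  { s with
    clock := s.clock + δ
    y := fun S => if s.IsGrowing S then s.y S + δ else s.y S }

end State

/-- A resolution of all the choices that the description of Greedy Dual leaves open: which free pair
to match if there are several candidates, which tight edge to process if there are several, and
whether, when a request arrives at a moment at which there is also a tight edge, the arrival or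
the tight edge is processed first. The choices are functions of the current state, hence of the
past only. -/
structure TieBreaking where
  pick : State → ℕ × ℕ
  pick_spec : ∀ s : State, (∃ u v, s.IsMatchable u v) → s.IsMatchable (pick s).1 (pick s).2
  edge : State → ℕ × ℕ
  edge_spec : ∀ s : State, (∃ u v, s.IsTight u v) → s.IsTight (edge s).1 (edge s).2
  arrivalFirst : State → Prop

open scoped Classical in
instance : Nonempty TieBreaking :=
  ⟨{ pick := fun s => if h : ∃ p : ℕ × ℕ, s.IsMatchable p.1 p.2 then h.choose else (0, 0)
     pick_spec := by
       rintro s ⟨u, v, huv⟩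
       have h : ∃ p : ℕ × ℕ, s.IsMatchable p.1 p.2 := ⟨(u, v), huv⟩
       simpa only [dif_pos h] using h.choose_spec
     edge := fun s => if h : ∃ p : ℕ × ℕ, s.IsTight p.1 p.2 then h.choose else (0, 0)
     edge_spec := by
       rintro s ⟨u, v, huv⟩
       have h : ∃ p : ℕ × ℕ, s.IsTight p.1 p.2 := ⟨(u, v), huv⟩
       simpa only [dif_pos h] using h.choose_spec
     arrivalFirst := fun _ => True }⟩

section Execution

variable {X : Type u} [MetricSpace X]

/-- The next request of the input arrives right now. -/
def Pending (I : Input X) (s : State) : Prop :=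
  s.num < 2 * I.m ∧ (I.req s.num).atime = s.clock

/-- Some request arrives right now, or some dual constraint between active sets is tight. -/
def HasEvent (I : Input X) (s : State) : Prop :=
  Pending I s ∨ ∃ u v, s.IsTight u v

/-- One step of Greedy Dual on the input `I`. After a merge, free pairs inside the new active set are
matched as long as there are any. Then arrivals and tight constraints are processed. If there are
none, time passes until the first moment at which there is one. The input is accessed only through
the information revealed by a request at the moment of its arrival. -/
inductive Step (ρ : TieBreaking) (I : Input X) : State → State → Prop
  | pair (s : State) :
      (∃ u v, s.IsMatchable u v) →
      Step ρ I s (s.pair (ρ.pick s).1 (ρ.pick s).2)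
  | arrive (s : State) :
      (¬∃ u v, s.IsMatchable u v) → Pending I s →
      ((∃ u v, s.IsTight u v) → ρ.arrivalFirst s) →
      Step ρ I s (s.arrive (I.arrival s.num))
  | merge (s : State) :
      (¬∃ u v, s.IsMatchable u v) → (∃ u v, s.IsTight u v) →
      (Pending I s → ¬ρ.arrivalFirst s) →
      Step ρ I s (s.merge (ρ.edge s).1 (ρ.edge s).2)
  | wait (s : State) (δ : ℝ) :
      (¬∃ u v, s.IsMatchable u v) → 0 < δ →
      (∀ ε, 0 ≤ ε → ε < δ → ¬HasEvent I (s.grow ε)) → HasEvent I (s.grow δ) →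
      Step ρ I s (s.grow δ)

/-- Greedy Dual, started at time `t₀` on the input `I`, comes after finitely many steps to the state
`s`, in which no further event will ever happen. Its output is then `s.matching`. -/
def HaltsAt (ρ : TieBreaking) (I : Input X) (t₀ : ℝ) (s : State) : Prop :=
  Relation.ReflTransGen (Step ρ I) (State.init t₀) s ∧ ∀ s', ¬Step ρ I s s'

/-- Two inputs, possibly from different metric spaces and with different numbers of requests, reveal
the same information up to and including time `τ`. -/
def SameUntil {Y : Type v} [MetricSpace Y] (I : Input X) (J : Input Y) (τ : ℝ) : Prop :=
  ∃ k, k ≤ 2 * I.m ∧ k ≤ 2 * J.m ∧ (∀ i < k, I.arrival i = J.arrival i) ∧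
    (∀ i, k ≤ i → i < 2 * I.m → τ < (I.req i).atime) ∧
    (∀ i, k ≤ i → i < 2 * J.m → τ < (J.req i).atime)

end Execution

end

end MPMD

namespace MPMD

open Finset

/-! The argument is primal-dual. GD never violates a constraint `load ≤ edgeCost`: a separated pair
stops time when it becomes tight and is then merged, and a newly arrived request starts with dual
sum 0. So the total load of the edges of any feasible solution `M` is at most the cost of `M`.
Regrouped by sets, this total weighs each `y S` by the number of edges of `M` that leave `S`. No LP
duality is needed, and each `M` is treated separately.

While `S` grows, its free requests cannot be matched with each other, and its matched requests
cancel in pairs. By parity, or by balance of signs, at least as many edges of `M` leave `S` as `S`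
has free requests, and this number is at least 1 (`card_free_le`). Integrated over time, both the
waiting cost of GD and the sum of all `y S` are at most `cost M` (`Charged`).

For connection costs, active sets are joined along tight edges. A telescoping estimate (`dist_le` in
`Invariant`) bounds the distance within an active set by twice the sum of all `y S`. Each of the `m`
matched pairs thus has distance at most `2 * cost M`; adding the waiting cost gives `2m + 1`.

Termination follows from a decreasing rank, uniqueness from determinism of the steps, and the online
property from the fact that a step ending by time `τ` uses only what is revealed by `τ`. -/

open scoped Classical in
/-- The total value of the dual variables of the sets of arrived requests that satisfy `P`. -/
noncomputable def State.ysum (s : State) (P : Finset ℕ → Prop) : ℝ :=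
  ∑ S ∈ (range s.num).powerset.filter P, s.y S

open scoped Classical in
/-- The growing active sets. -/
noncomputable def State.growing (s : State) : Finset (Finset ℕ) :=
  (range s.num).powerset.filter s.IsGrowing

open scoped Classical in
/-- The number of growing active sets that satisfy `P`. -/
noncomputable def State.growth (s : State) (P : Finset ℕ → Prop) : ℕ :=
  #(s.growing.filter P)

open scoped Classical in
/-- The free requests. -/
noncomputable def State.free (s : State) : Finset ℕ :=
  (range s.num).filter s.IsFree

/-- `S` contains exactly one endpoint of the edge `(u, v)`. -/
def Separates (u v : ℕ) (S : Finset ℕ) : Prop := ¬(u ∈ S ↔ v ∈ S)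

/-! ### Sums of dual variables over families of sets. -/

namespace State

lemma mem_free {s : State} {u : ℕ} : u ∈ s.free ↔ s.IsFree u := by
  simp only [free, mem_filter, mem_range, and_iff_right_iff_imp]
  exact fun h => h.1

lemma load_eq_ysum (s : State) (u v : ℕ) : s.load u v = s.ysum (Separates u v) := by
  unfold load ysum Separates
  exact Finset.sum_congr (by ext; simp) fun _ _ => rfl

lemma ysum_grow (s : State) (δ : ℝ) (P : Finset ℕ → Prop) :
    (s.grow δ).ysum P = s.ysum P + δ * s.growth P := by
  classical
  have h : ∀ S, (s.grow δ).y S = s.y S + if s.IsGrowing S then δ else 0 := by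
    intro S
    simp only [grow]
    split_ifs <;> simp
  unfold ysum growth growing
  simp only [h, sum_add_distrib]
  congr 1
  rw [← sum_filter, sum_const, nsmul_eq_mul, mul_comm, filter_filter, filter_filter]
  simp only [and_comm]
  rfl

/-- The additional sets in the range of summation are those that contain the new request, and their
variables are reset to 0. -/
lemma ysum_arrive (s : State) (a : Arrival) (P : Finset ℕ → Prop) :
    (s.arrive a).ysum P = s.ysum P := by
  classical
  unfold ysum
  symm
  have hy : ∀ S ∈ (range s.num).powerset, (s.arrive a).y S = s.y S := by
    intro S hS
    have : s.num ∉ S := fun h => by simpa using mem_powerset.1 hS h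
    simp [arrive, this]
  rw [Finset.sum_congr rfl fun S hS => (hy S (mem_filter.1 hS).1).symm]
  apply Finset.sum_subset
  · apply filter_subset_filter
    apply powerset_mono.2
    simp [arrive]
  · intro S hS hS'
    simp only [arrive, mem_filter, mem_powerset] at hS hS' ⊢
    rw [if_pos]
    by_contra hn
    apply hS' ⟨_, hS.2⟩
    intro x hx
    have := mem_range.1 (hS.1 hx)
    have hne : x ≠ s.num := fun h => hn (h ▸ hx)
    exact mem_range.2 (by omega)

lemma ysum_mono {s : State} (hy : ∀ S, 0 ≤ s.y S) {P Q : Finset ℕ → Prop} (h : ∀ S, P S → Q S) :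
    s.ysum P ≤ s.ysum Q := by
  classical
  exact Finset.sum_le_sum_of_subset_of_nonneg (monotone_filter_right _ fun S _ hS => h S hS)
    fun S _ _ => hy S

lemma ysum_nonneg {s : State} (hy : ∀ S, 0 ≤ s.y S) (P : Finset ℕ → Prop) : 0 ≤ s.ysum P :=
  Finset.sum_nonneg fun S _ => hy S

lemma ysum_eq_zero {s : State} {P : Finset ℕ → Prop} (h : ∀ S, P S → s.y S = 0) :
    s.ysum P = 0 := by
  classical
  exact Finset.sum_eq_zero fun S hS => h S (mem_filter.1 hS).2

lemma ysum_or_add_ysum_and (s : State) (P Q : Finset ℕ → Prop) :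
    s.ysum (fun S => P S ∨ Q S) + s.ysum (fun S => P S ∧ Q S) = s.ysum P + s.ysum Q := by
  simp only [ysum, sum_filter, ← sum_add_distrib]
  refine Finset.sum_congr rfl fun S _ => ?_
  by_cases hP : P S <;> by_cases hQ : Q S <;> simp [hP, hQ]

lemma ysum_or_le {s : State} (hy : ∀ S, 0 ≤ s.y S) (P Q : Finset ℕ → Prop) :
    s.ysum (fun S => P S ∨ Q S) ≤ s.ysum P + s.ysum Q := by
  have := s.ysum_or_add_ysum_and P Q
  have := ysum_nonneg hy fun S => P S ∧ Q S
  linarith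

lemma ysum_add_le {s : State} (hy : ∀ S, 0 ≤ s.y S) {P Q R : Finset ℕ → Prop}
    (hP : ∀ S, P S → R S) (hQ : ∀ S, Q S → R S) (h0 : ∀ S, P S → Q S → s.y S = 0) :
    s.ysum P + s.ysum Q ≤ s.ysum R := by
  rw [← ysum_or_add_ysum_and, ysum_eq_zero (P := fun S => P S ∧ Q S) fun S hS => h0 S hS.1 hS.2,
    add_zero]
  exact ysum_mono hy fun S hS => hS.elim (hP S) (hQ S)

lemma growth_le_card (s : State) (P : Finset ℕ → Prop) : s.growth P ≤ #s.growing := by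
  classical
  exact card_filter_le _ _

lemma grow_zero (s : State) : s.grow 0 = s := by
  simp [grow]

end State

/-- The cost of matching `u` with `v` as soon as both have arrived. -/
noncomputable def Input.edgeCost {X : Type u} [MetricSpace X] (I : Input X) (u v : ℕ) : ℝ :=
  dist (I.req u).pos (I.req v).pos + |(I.req u).atime - (I.req v).atime|

/-! ### The invariants -/

section

variable {X : Type u} [MetricSpace X]

/-- The invariants of Greedy Dual. -/
structure Invariant (I : Input X) (s : State) : Prop where
  num_le : s.num ≤ 2 * I.m
  info : ∀ i < s.num, s.info i = I.arrival i
  atime_le : ∀ i < s.num, (I.req i).atime ≤ s.clock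
  le_atime : s.num < 2 * I.m → s.clock ≤ (I.req s.num).atime
  mem_active : ∀ u < s.num, ∀ w, w ∈ s.active u ↔ w < s.num ∧ s.active w = s.active u
  y_nonneg : ∀ S, 0 ≤ s.y S
  y_empty : s.y ∅ = 0
  -- At most one growing set contains `u` at a time. This makes the constraints between `u` and a
  -- later arrival hold initially: their load is the height of `u`, at most the difference of the
  -- arrival times.
  height_le : ∀ u < s.num, s.ysum (fun S => u ∈ S) ≤ s.clock - (I.req u).atime
  load_le : ∀ u < s.num, ∀ v < s.num, u ≠ v → (I.req u).sgn = -(I.req v).sgn →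
    s.ysum (Separates u v) ≤ I.edgeCost u v
  -- Subtracting the heights of both endpoints makes the bound telescope when two active sets merge.
  dist_le : ∀ u < s.num, ∀ v < s.num, s.active u = s.active v →
    dist (I.req u).pos (I.req v).pos ≤
      2 * s.ysum (fun S => S ⊆ s.active u) - s.ysum (fun S => u ∈ S) - s.ysum (fun S => v ∈ S)
  matched : ∀ e ∈ s.matching, e.fst < s.num ∧ e.snd < s.num ∧ e.fst ≠ e.snd ∧
    (I.req e.fst).sgn = -(I.req e.snd).sgn ∧ (I.req e.fst).atime ≤ e.time ∧
    (I.req e.snd).atime ≤ e.time ∧ s.active e.fst = s.active e.snd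
  matched_unique : ∀ e ∈ s.matching, ∀ e' ∈ s.matching, ∀ u, (e.fst = u ∨ e.snd = u) →
    (e'.fst = u ∨ e'.snd = u) → e = e'
  -- Stated with the total dual sum, which never decreases, so that the bound survives after the
  -- pair is matched.
  matched_dist : ∀ e ∈ s.matching,
    dist (I.req e.fst).pos (I.req e.snd).pos ≤ 2 * s.ysum (fun _ => True)

namespace Invariant

variable {I : Input X} {s : State}

lemma mem_self (h : Invariant I s) {u : ℕ} (hu : u < s.num) : u ∈ s.active u :=
  (h.mem_active u hu u).2 ⟨hu, rfl⟩

lemma rdist_eq (h : Invariant I s) {u v : ℕ} (hu : u < s.num) (hv : v < s.num) :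
    s.rdist u v = dist (I.req u).pos (I.req v).pos := by
  unfold State.rdist
  rw [h.info _ (max_lt hu hv)]
  rcases lt_trichotomy u v with huv | rfl | huv
  · simp [Input.arrival, max_eq_right huv.le, min_eq_left huv.le, huv, dist_comm]
  · simp [Input.arrival]
  · simp [Input.arrival, max_eq_left huv.le, min_eq_right huv.le, huv]

lemma edgeCost_eq (h : Invariant I s) {u v : ℕ} (hu : u < s.num) (hv : v < s.num) :
    s.edgeCost u v = I.edgeCost u v := by
  unfold State.edgeCost Input.edgeCost
  rw [h.rdist_eq hu hv, h.info u hu, h.info v hv]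
  rfl

lemma isEdge_iff (h : Invariant I s) {u v : ℕ} :
    s.IsEdge u v ↔ u < s.num ∧ v < s.num ∧ u ≠ v ∧ (I.req u).sgn = -(I.req v).sgn := by
  unfold State.IsEdge
  constructor
  · rintro ⟨hu, hv, hne, hs⟩
    rw [h.info u hu, h.info v hv] at hs
    exact ⟨hu, hv, hne, hs⟩
  · rintro ⟨hu, hv, hne, hs⟩
    rw [h.info u hu, h.info v hv]
    exact ⟨hu, hv, hne, hs⟩

lemma active_eq (h : Invariant I s) {S : Finset ℕ} (hS : s.IsGrowing S) {u : ℕ} (hu : u ∈ S) :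
    u < s.num ∧ s.active u = S := by
  obtain ⟨⟨w, hw, rfl⟩, -⟩ := hS
  exact (h.mem_active w hw u).1 hu

lemma isGrowing_active (h : Invariant I s) {u : ℕ} (hu : s.IsFree u) :
    s.IsGrowing (s.active u) :=
  ⟨⟨u, hu.1, rfl⟩, u, h.mem_self hu.1, hu⟩

lemma active_subset (h : Invariant I s) {u : ℕ} (hu : u < s.num) : s.active u ⊆ range s.num :=
  fun w hw => mem_range.2 ((h.mem_active u hu w).1 hw).1

lemma mem_growing (h : Invariant I s) {S : Finset ℕ} : S ∈ s.growing ↔ s.IsGrowing S := by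
  simp only [State.growing, mem_filter, mem_powerset, and_iff_right_iff_imp]
  rintro ⟨⟨u, hu, rfl⟩, -⟩
  exact h.active_subset hu

lemma init {t₀ : ℝ} (ht : ∀ i < 2 * I.m, t₀ ≤ (I.req i).atime) : Invariant I (State.init t₀) where
  num_le := Nat.zero_le _
  info i hi := absurd hi (Nat.not_lt_zero i)
  atime_le i hi := absurd hi (Nat.not_lt_zero i)
  le_atime h := ht _ h
  mem_active i hi := absurd hi (Nat.not_lt_zero i)
  y_nonneg _ := le_rfl
  y_empty := rfl
  height_le i hi := absurd hi (Nat.not_lt_zero i)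
  load_le i hi := absurd hi (Nat.not_lt_zero i)
  dist_le i hi := absurd hi (Nat.not_lt_zero i)
  matched e he := absurd he (notMem_empty e)
  matched_unique e he := absurd he (notMem_empty e)
  matched_dist e he := absurd he (notMem_empty e)

open scoped Classical in
lemma pair (h : Invariant I s) {u v : ℕ} (huv : s.IsMatchable u v) : Invariant I (s.pair u v) where
  num_le := h.num_le
  info := h.info
  atime_le := h.atime_le
  le_atime := h.le_atime
  mem_active := h.mem_active
  y_nonneg := h.y_nonneg
  y_empty := h.y_empty
  height_le := h.height_le
  load_le := h.load_le
  dist_le := h.dist_le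
  matched e he := by
    obtain ⟨hu, hv, hne, hs⟩ := h.isEdge_iff.1 huv.1
    rcases mem_insert.1 he with rfl | he
    · exact ⟨hu, hv, hne, hs, h.atime_le u hu, h.atime_le v hv, huv.2.1⟩
    · exact h.matched e he
  matched_unique e he e' he' w hw hw' := by
    obtain ⟨-, -, hu, hv⟩ := huv
    have key : ∀ e ∈ s.matching, (e.fst = w ∨ e.snd = w) → ¬(u = w ∨ v = w) := by
      rintro e he hw (rfl | rfl)
      · have := hu.2 e he; tauto
      · have := hv.2 e he; tauto
    rcases mem_insert.1 he with rfl | he1 <;> rcases mem_insert.1 he' with rfl | he2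
    · rfl
    · exact absurd hw (key e' he2 hw')
    · exact absurd hw' (key e he1 hw)
    · exact h.matched_unique e he1 e' he2 w hw hw'
  matched_dist e he := by
    obtain ⟨hu, hv, hne, hs⟩ := h.isEdge_iff.1 huv.1
    rcases mem_insert.1 he with rfl | he
    · have h1 := h.dist_le u hu v hv huv.2.1
      have h2 := State.ysum_nonneg h.y_nonneg (fun S => u ∈ S)
      have h3 := State.ysum_nonneg h.y_nonneg (fun S => v ∈ S)
      have h4 : s.ysum (fun S => S ⊆ s.active u) ≤ s.ysum fun _ => True :=
        State.ysum_mono h.y_nonneg fun _ _ => trivial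
      change _ ≤ 2 * s.ysum fun _ => True
      simp only
      linarith
    · exact h.matched_dist e he

lemma arrive (h : Invariant I s) (hp : Pending I s) : Invariant I (s.arrive (I.arrival s.num)) := by
  obtain ⟨hlt, htime⟩ := hp
  have hy : ∀ S, 0 ≤ (s.arrive (I.arrival s.num)).y S := by
    intro S
    simp only [State.arrive]
    split_ifs
    exacts [le_rfl, h.y_nonneg S]
  have hact : ∀ u < s.num, (s.arrive (I.arrival s.num)).active u = s.active u := by
    intro u hu
    simp [State.arrive, hu.ne]
  have hnew : (s.arrive (I.arrival s.num)).active s.num = {s.num} := by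
    simp [State.arrive]
  have hne : ∀ u < s.num, s.active u ≠ {s.num} := by
    intro u hu he
    have := h.mem_self hu
    rw [he, mem_singleton] at this
    omega
  have hzero : (s.arrive (I.arrival s.num)).ysum (fun S => s.num ∈ S) = 0 :=
    State.ysum_eq_zero fun S hS => if_pos hS
  have hcase : ∀ u < s.num + 1, u < s.num ∨ u = s.num := fun u hu => by omega
  refine ⟨hlt, ?_, ?_, ?_, ?_, hy, ?_, ?_, ?_, ?_, ?_, h.matched_unique, ?_⟩
  · intro i hi
    rcases hcase i hi with hi | rfl
    · simp [State.arrive, hi.ne, h.info i hi]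
    · simp [State.arrive]
  · intro i hi
    rcases hcase i hi with hi | rfl
    · exact h.atime_le i hi
    · exact htime.le
  · intro hn
    change s.clock ≤ _
    rw [← htime]
    exact I.sorted _ _ (Nat.le_succ _) hn
  · intro u hu w
    change _ ↔ w < s.num + 1 ∧ _
    rcases hcase u hu with hu | rfl
    · rw [hact u hu, h.mem_active u hu]
      constructor
      · rintro ⟨hw, hw'⟩
        exact ⟨by omega, by rw [hact w hw, hw']⟩
      · rintro ⟨hw, hw'⟩
        rcases hcase w hw with hw | rfl
        · exact ⟨hw, by rwa [hact w hw] at hw'⟩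
        · rw [hnew] at hw'
          exact absurd hw'.symm (hne u hu)
    · rw [hnew, mem_singleton]
      constructor
      · rintro rfl
        exact ⟨by omega, hnew⟩
      · rintro ⟨hw, hw'⟩
        rcases hcase w hw with hw | rfl
        · rw [hact w hw] at hw'
          exact absurd hw' (hne w hw)
        · rfl
  · simp [State.arrive, h.y_empty]
  · intro u hu
    rcases hcase u hu with hu | rfl
    · rw [State.ysum_arrive]
      exact h.height_le u hu
    · rw [hzero]
      simp [State.arrive, htime]
  · have key : ∀ u < s.num, s.ysum (fun S => u ∈ S) ≤ I.edgeCost u s.num := by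
      intro u hu
      have h1 := h.height_le u hu
      have h2 : (I.req s.num).atime - (I.req u).atime ≤
          |(I.req u).atime - (I.req s.num).atime| := by
        rw [abs_sub_comm]
        exact le_abs_self _
      have h3 := dist_nonneg (x := (I.req u).pos) (y := (I.req s.num).pos)
      unfold Input.edgeCost
      linarith
    have hsep : ∀ u, (s.arrive (I.arrival s.num)).ysum (Separates u s.num) ≤
        s.ysum fun S => u ∈ S := by
      intro u
      have := State.ysum_or_le hy (fun S => u ∈ S) (fun S => s.num ∈ S)
      rw [hzero, add_zero, State.ysum_arrive _ _ (fun S => u ∈ S)] at this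
      refine (State.ysum_mono hy fun S hS => ?_).trans this
      unfold Separates at hS
      tauto
    intro u hu v hv huv hs
    rcases hcase u hu with hu | rfl <;> rcases hcase v hv with hv | rfl
    · rw [State.ysum_arrive]
      exact h.load_le u hu v hv huv hs
    · exact (hsep u).trans (key u hu)
    · have h1 : Separates s.num v = Separates v s.num := by
        ext S; simp only [Separates]; tauto
      have h2 : I.edgeCost s.num v = I.edgeCost v s.num := by
        simp only [Input.edgeCost, dist_comm, abs_sub_comm]
      rw [h1, h2]
      exact (hsep v).trans (key v hv)
    · exact absurd rfl huv
  · intro u hu v hv huv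
    rcases hcase u hu with hu | rfl <;> rcases hcase v hv with hv | rfl
    · simp only [hact u hu, hact v hv, State.ysum_arrive] at huv ⊢
      exact h.dist_le u hu v hv huv
    · rw [hact u hu, hnew] at huv
      exact absurd huv (hne u hu)
    · rw [hact v hv, hnew] at huv
      exact absurd huv.symm (hne v hv)
    · rw [dist_self, hzero]
      have := State.ysum_nonneg hy (fun S => S ⊆ (s.arrive (I.arrival s.num)).active s.num)
      linarith
  · intro e he
    obtain ⟨h1, h2, h3, h4, h5, h6, h7⟩ := h.matched e he
    exact ⟨Nat.lt_succ_of_lt h1, Nat.lt_succ_of_lt h2, h3, h4, h5, h6,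
      by rw [hact _ h1, hact _ h2, h7]⟩
  · intro e he
    rw [State.ysum_arrive]
    exact h.matched_dist e he

/-- Write `h` for heights and `W` for the dual sum over subsets of an active set. For `u` on the
side of `a` and `v` on the side of `b`, tightness gives `dist a b ≤ h a + h b`. Adding `dist u a ≤ 2
W_a - h u - h a` and `dist b v ≤ 2 W_b - h b - h v` cancels the heights at `a` and `b`, and `W_a +
W_b ≤ W` on the union. -/
lemma merge (h : Invariant I s) {a b : ℕ} (hab : s.IsTight a b) : Invariant I (s.merge a b) := by
  obtain ⟨hedge, hact, htight⟩ := hab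
  obtain ⟨ha, hb, hne, -⟩ := h.isEdge_iff.1 hedge
  have hin : ∀ w, w ∈ s.active a ∪ s.active b →
      (s.merge a b).active w = s.active a ∪ s.active b := fun w hw => by
    simp only [State.merge, if_pos hw]
  have hout : ∀ w, w ∉ s.active a ∪ s.active b →
      (s.merge a b).active w = s.active w := fun w hw => by
    simp only [State.merge, if_neg hw]
  have hmem : ∀ w, w ∈ s.active a ∪ s.active b →
      w < s.num ∧ (s.active w = s.active a ∨ s.active w = s.active b) := by
    intro w hw
    rcases mem_union.1 hw with hw | hw
    · have := (h.mem_active a ha w).1 hw; tauto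
    · have := (h.mem_active b hb w).1 hw; tauto
  have hclass : ∀ w < s.num, w ∈ s.active a ∪ s.active b ↔
      s.active w = s.active a ∨ s.active w = s.active b := by
    intro w hw
    rw [mem_union, h.mem_active a ha, h.mem_active b hb]
    tauto
  have hcost : dist (I.req a).pos (I.req b).pos ≤
      s.ysum (fun S => a ∈ S) + s.ysum fun S => b ∈ S := by
    rw [h.edgeCost_eq ha hb, State.load_eq_ysum] at htight
    have h1 : dist (I.req a).pos (I.req b).pos ≤ I.edgeCost a b :=
      le_add_of_nonneg_right (abs_nonneg _)
    refine (h1.trans htight.ge).trans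
      (le_trans ?_ (State.ysum_or_le h.y_nonneg (fun S => a ∈ S) (fun S => b ∈ S)))
    refine State.ysum_mono h.y_nonneg fun S hS => ?_
    unfold Separates at hS
    tauto
  have hunion : s.ysum (fun S => S ⊆ s.active a) + s.ysum (fun S => S ⊆ s.active b) ≤
      s.ysum fun S => S ⊆ s.active a ∪ s.active b := by
    refine State.ysum_add_le h.y_nonneg (fun S hS => hS.trans subset_union_left)
      (fun S hS => hS.trans subset_union_right) fun S hSa hSb => ?_
    -- The two active sets are disjoint, so only the empty set lies in both; this is what `y_empty`
    -- is for.
    suffices S = ∅ by rw [this, h.y_empty]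
    refine eq_empty_of_forall_notMem fun x hx => hact ?_
    rw [← ((h.mem_active a ha x).1 (hSa hx)).2, ← ((h.mem_active b hb x).1 (hSb hx)).2]
  have hWa := State.ysum_nonneg h.y_nonneg (fun S => S ⊆ s.active a)
  have hWb := State.ysum_nonneg h.y_nonneg (fun S => S ⊆ s.active b)
  refine ⟨h.num_le, h.info, h.atime_le, h.le_atime, ?_, h.y_nonneg, h.y_empty, h.height_le,
    h.load_le, ?_, ?_, h.matched_unique, h.matched_dist⟩
  · intro u hu w
    change u < s.num at hu
    change _ ↔ w < s.num ∧ _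
    by_cases huU : u ∈ s.active a ∪ s.active b
    · rw [hin u huU]
      constructor
      · exact fun hw => ⟨(hmem w hw).1, hin w hw⟩
      · rintro ⟨hw, hw'⟩
        by_contra hn
        rw [hout w hn] at hw'
        exact hn (hw' ▸ h.mem_self hw)
    · rw [hout u huU, h.mem_active u hu]
      refine and_congr_right fun hw => ?_
      by_cases hwU : w ∈ s.active a ∪ s.active b
      · rw [hin w hwU]
        constructor
        · intro he
          rw [hclass w hw, he, ← hclass u hu] at hwU
          exact absurd hwU huU
        · intro he
          exact absurd (he ▸ h.mem_self hu) huU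
      · rw [hout w hwU]
  · intro u hu v hv huv
    change u < s.num at hu
    change v < s.num at hv
    change _ ≤ 2 * s.ysum (fun S => S ⊆ (s.merge a b).active u) - s.ysum (fun S => u ∈ S) -
      s.ysum fun S => v ∈ S
    by_cases huU : u ∈ s.active a ∪ s.active b
    · have hvU : v ∈ s.active a ∪ s.active b := by
        by_contra hn
        rw [hin u huU, hout v hn] at huv
        exact hn (huv ▸ h.mem_self hv)
      rw [hin u huU]
      have t1 := dist_triangle4 (I.req u).pos (I.req a).pos (I.req b).pos (I.req v).pos
      have t2 := dist_triangle4 (I.req u).pos (I.req b).pos (I.req a).pos (I.req v).pos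
      have t3 := dist_comm (I.req a).pos (I.req b).pos
      rcases (hmem u huU).2 with hua | hub <;> rcases (hmem v hvU).2 with hva | hvb
      · have := h.dist_le u hu v hv (hua.trans hva.symm)
        rw [hua] at this
        linarith
      · have d1 := h.dist_le u hu a ha hua
        have d2 := h.dist_le b hb v hv hvb.symm
        rw [hua] at d1
        linarith
      · have d1 := h.dist_le u hu b hb hub
        have d2 := h.dist_le a ha v hv hva.symm
        rw [hub] at d1
        linarith
      · have := h.dist_le u hu v hv (hub.trans hvb.symm)
        rw [hub] at this
        linarith
    · have hvU : v ∉ s.active a ∪ s.active b := by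
        intro hn
        rw [hout u huU, hin v hn] at huv
        exact huU (huv ▸ h.mem_self hu)
      rw [hout u huU, hout v hvU] at huv
      rw [hout u huU]
      exact h.dist_le u hu v hv huv
  · intro e he
    obtain ⟨h1, h2, h3, h4, h5, h6, h7⟩ := h.matched e he
    refine ⟨h1, h2, h3, h4, h5, h6, ?_⟩
    by_cases hU : e.fst ∈ s.active a ∪ s.active b
    · have hU' := hU
      rw [hclass _ h1, h7, ← hclass _ h2] at hU'
      rw [hin _ hU, hin _ hU']
    · have hU' := hU
      rw [hclass _ h1, h7, ← hclass _ h2] at hU'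
      rw [hout _ hU, hout _ hU', h7]

/-- An arrival skipped or a constraint violated by the wait would have been an event strictly before
its end, by linearity in the elapsed time. -/
lemma grow (h : Invariant I s) {δ : ℝ} (hδ : 0 < δ)
    (hn : ∀ ε, 0 ≤ ε → ε < δ → ¬HasEvent I (s.grow ε)) : Invariant I (s.grow δ) where
  num_le := h.num_le
  info := h.info
  atime_le i hi := (h.atime_le i hi).trans (le_add_of_nonneg_right hδ.le)
  le_atime hlt := by
    change s.clock + δ ≤ (I.req s.num).atime
    by_contra! hc
    refine hn ((I.req s.num).atime - s.clock) (sub_nonneg.2 (h.le_atime hlt)) (by linarith)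
      (Or.inl ⟨hlt, ?_⟩)
    simp [State.grow]
  mem_active := h.mem_active
  y_nonneg S := by
    simp only [State.grow]
    have := h.y_nonneg S
    split_ifs <;> linarith
  y_empty := by
    simp only [State.grow]
    rw [if_neg, h.y_empty]
    rintro ⟨-, u, hu, -⟩
    exact notMem_empty u hu
  height_le u hu := by
    rw [State.ysum_grow]
    have h1 : s.growth (fun S => u ∈ S) ≤ 1 := by
      refine card_le_one.2 fun S hS T hT => ?_
      simp only [mem_filter, h.mem_growing] at hS hT
      rw [← (h.active_eq hS.1 hS.2).2, ← (h.active_eq hT.1 hT.2).2]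
    have h2 : (s.growth (fun S => u ∈ S) : ℝ) ≤ 1 := by exact_mod_cast h1
    have h3 := h.height_le u hu
    have h4 := mul_le_of_le_one_right hδ.le h2
    change _ ≤ s.clock + δ - _
    linarith
  load_le u hu v hv huv hs := by
    classical
    have hle := h.load_le u hu v hv huv hs
    rw [State.ysum_grow]
    set n := s.growth (Separates u v) with hndef
    by_cases hact : s.active u = s.active v
    · have : n = 0 := by
        rw [hndef, State.growth, card_eq_zero, filter_eq_empty_iff]
        intro S hS hsep
        rw [h.mem_growing] at hS
        obtain ⟨⟨w, hw, rfl⟩, -⟩ := hS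
        apply hsep
        rw [h.mem_active w hw, h.mem_active w hw, hact]
        tauto
      rw [this]
      simpa using hle
    · by_contra! hc
      have hn0 : (0 : ℝ) < n := by
        rcases Nat.eq_zero_or_pos n with h0 | h0
        · rw [h0] at hc
          simp only [Nat.cast_zero, mul_zero, add_zero] at hc
          linarith
        · exact_mod_cast h0
      -- The remaining slack divided by the growth rate is the moment at which the constraint
      -- becomes tight.
      refine hn ((I.edgeCost u v - s.ysum (Separates u v)) / n) (by
        apply div_nonneg <;> linarith) (by rw [div_lt_iff₀ hn0]; linarith)
        (Or.inr ⟨u, v, h.isEdge_iff.2 ⟨hu, hv, huv, hs⟩, hact, ?_⟩)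
      rw [State.load_eq_ysum, State.ysum_grow, ← hndef, div_mul_cancel₀ _ hn0.ne']
      change _ = s.edgeCost u v
      rw [h.edgeCost_eq hu hv]
      ring
  dist_le u hu v hv huv := by
    rw [State.ysum_grow, State.ysum_grow, State.ysum_grow]
    have hle := h.dist_le u hu v hv huv
    -- A growing set that contains `w` can only be the active set of `u`, so each subtracted height
    -- grows no faster than the sum that is doubled.
    have key : ∀ w < s.num, s.active w = s.active u →
        (s.growth (fun S => w ∈ S) : ℝ) ≤ s.growth fun S => S ⊆ s.active u := by
      intro w hw hwu
      refine Nat.cast_le.2 (card_le_card fun S hS => ?_)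
      simp only [mem_filter, h.mem_growing] at hS ⊢
      refine ⟨hS.1, ?_⟩
      rw [← (h.active_eq hS.1 hS.2).2, hwu]
    have h1 := key u hu rfl
    have h2 := key v hv huv.symm
    change dist _ _ ≤ 2 * s.ysum (fun S => S ⊆ s.active u) - _ - _ at hle
    change dist _ _ ≤ 2 * (s.ysum (fun S => S ⊆ s.active u) +
      δ * s.growth fun S => S ⊆ s.active u) - _ - _
    nlinarith
  matched := h.matched
  matched_unique := h.matched_unique
  matched_dist e he := by
    rw [State.ysum_grow]
    have := h.matched_dist e he
    have : 0 ≤ δ * (s.growth (fun _ => True) : ℝ) := by positivity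
    linarith

lemma step (h : Invariant I s) {ρ : TieBreaking} {s' : State} (hs : Step ρ I s s') :
    Invariant I s' := by
  cases hs with
  | pair hm => exact h.pair (ρ.pick_spec s hm)
  | arrive _ hp _ => exact h.arrive hp
  | merge _ ht _ => exact h.merge (ρ.edge_spec s ht)
  | wait δ _ hδ hn _ => exact h.grow hδ hn

lemma reflTransGen (h : Invariant I s) {ρ : TieBreaking} {s' : State}
    (hs : Relation.ReflTransGen (Step ρ I) s s') : Invariant I s' := by
  induction hs with
  | refl => exact h
  | tail _ hst ih => exact ih.step hst

end Invariant

end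

/-! ### Counting free requests -/

/-- Sending each request to its partner is a fixed-point-free involution of `B` that pairs off
cancelling weights. The group stays general because the two variants need different ones: `ZMod 2`
for parity, `ℤ` for signs. -/
lemma sum_eq_zero_of_matched {G : Type*} [AddCommGroup G] {M : Finset MatchEdge} {B : Finset ℕ}
    {w : ℕ → G} (hw : ∀ e ∈ M, w e.fst + w e.snd = 0) (hne : ∀ e ∈ M, e.fst ≠ e.snd)
    (huniq : ∀ e ∈ M, ∀ e' ∈ M, ∀ u, (e.fst = u ∨ e.snd = u) → (e'.fst = u ∨ e'.snd = u) → e = e')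
    (hcov : ∀ u ∈ B, ∃ e ∈ M, (e.fst = u ∧ e.snd ∈ B) ∨ (e.snd = u ∧ e.fst ∈ B)) :
    ∑ u ∈ B, w u = 0 := by
  have hex : ∀ u ∈ B, ∃ v, v ∈ B ∧
      ∃ e ∈ M, (e.fst = u ∧ e.snd = v) ∨ (e.snd = u ∧ e.fst = v) := by
    intro u hu
    obtain ⟨e, he, ⟨h1, h2⟩ | ⟨h1, h2⟩⟩ := hcov u hu
    · exact ⟨_, h2, e, he, Or.inl ⟨h1, rfl⟩⟩
    · exact ⟨_, h2, e, he, Or.inr ⟨h1, rfl⟩⟩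
  choose p hp hpe using hex
  refine Finset.sum_involution p ?_ ?_ hp ?_
  · intro u hu
    obtain ⟨e, he, ⟨h1, h2⟩ | ⟨h1, h2⟩⟩ := hpe u hu
    · rw [← h2, ← h1, hw e he]
    · rw [← h2, ← h1, add_comm, hw e he]
  · intro u hu _ heq
    obtain ⟨e, he, ⟨h1, h2⟩ | ⟨h1, h2⟩⟩ := hpe u hu
    · exact hne e he (h1.trans (heq.symm.trans h2.symm))
    · exact hne e he (h2.trans (heq.trans h1.symm))
  · intro u hu
    obtain ⟨e, he, h⟩ := hpe u hu
    obtain ⟨e', he', h'⟩ := hpe (p u hu) (hp u hu)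
    have := huniq e he e' he' (p u hu) (by tauto) (by tauto)
    subst this
    have := hne e he
    rcases h with ⟨h1, h2⟩ | ⟨h1, h2⟩ <;> rcases h' with ⟨h3, h4⟩ | ⟨h3, h4⟩
    · exact absurd (h3.trans h2.symm) this
    · rw [← h4, h1]
    · rw [← h4, h1]
    · exact absurd (h2.trans h3.symm) this

variable {X : Type u} {I : Input X} {s : State} {M : Finset MatchEdge}

/-- A set of requests no two of which can be matched is at most as large as any other set with the
same balance of polarities. -/
lemma card_le_card_of_balance (hI : I.IsMPMD ∨ I.IsMBPMD) {F C : Finset ℕ}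
    (hF : F ⊆ range (2 * I.m))
    (hom : ∀ u ∈ F, ∀ v ∈ F, u ≠ v → (I.req u).sgn ≠ -(I.req v).sgn)
    (hsum : ∀ {G : Type} [AddCommGroup G] (w : ℕ → G),
      (∀ u < 2 * I.m, ∀ v < 2 * I.m, (I.req u).sgn = -(I.req v).sgn → w u + w v = 0) →
      ∑ u ∈ F, w u = ∑ u ∈ C, w u) : #F ≤ #C := by
  rcases F.eq_empty_or_nonempty with rfl | ⟨a, ha⟩
  · simp
  have ha' := mem_range.1 (hF ha)
  rcases hI with hI | hI
  · have h1 : #F ≤ 1 := by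
      refine card_le_one.2 fun u hu v hv => ?_
      by_contra hne
      apply hom u hu v hv hne
      rw [hI u (mem_range.1 (hF hu)), hI v (mem_range.1 (hF hv))]
      rfl
    -- Without polarities `F` has at most one element, so equal parity suffices to exclude that `C`
    -- is empty.
    have h2 := hsum (fun _ => (1 : ZMod 2)) fun _ _ _ _ _ => by decide
    refine h1.trans (Nat.one_le_iff_ne_zero.2 fun h0 => ?_)
    have hF1 : #F = 1 := le_antisymm h1 (card_pos.2 ⟨a, ha⟩)
    simp [hF1, card_eq_zero.1 h0] at h2
  · have hsgn := hI.1
    have hadd : ∀ x y z : SignType, x = -y →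
        ((x * z : SignType) : ℤ) + ((y * z : SignType) : ℤ) = 0 := by decide
    have hle : ∀ x : SignType, ((x : SignType) : ℤ) ≤ 1 := by decide
    -- All requests in `F` have the polarity of `a`. Multiplying by it gives each of them weight 1,
    -- while no weight in `C` exceeds 1.
    have h := hsum (fun u => (((I.req u).sgn * (I.req a).sgn : SignType) : ℤ))
      fun u _ v _ huv => hadd _ _ _ huv
    have h1 : ∑ u ∈ F, (((I.req u).sgn * (I.req a).sgn : SignType) : ℤ) = #F := by
      rw [card_eq_sum_ones, Nat.cast_sum]
      refine Finset.sum_congr rfl fun u hu => ?_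
      have hua : (I.req u).sgn = (I.req a).sgn := by
        by_cases hne : u = a
        · rw [hne]
        · have := hom u hu a ha hne
          rcases hsgn u (mem_range.1 (hF hu)) with h1 | h1 <;>
            rcases hsgn a ha' with h2 | h2 <;> rw [h1, h2] at this ⊢ <;> exact absurd rfl this
      rw [hua]
      rcases hsgn a ha' with h2 | h2 <;> rw [h2] <;> rfl
    have h2 : ∑ u ∈ C, (((I.req u).sgn * (I.req a).sgn : SignType) : ℤ) ≤ #C := by
      rw [card_eq_sum_ones, Nat.cast_sum]
      exact Finset.sum_le_sum fun u _ => hle _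
    have h3 := h1.symm.trans_le (h.trans_le h2)
    exact_mod_cast h3

/-- The polarities of the whole input are balanced. -/
lemma sum_range_eq_zero (hI : I.IsMPMD ∨ I.IsMBPMD) {G : Type*} [AddCommGroup G] {w : ℕ → G}
    (hw : ∀ u < 2 * I.m, ∀ v < 2 * I.m, (I.req u).sgn = -(I.req v).sgn → w u + w v = 0) :
    ∑ u ∈ range (2 * I.m), w u = 0 := by
  rcases Nat.eq_zero_or_pos I.m with hm | hm
  · simp [hm]
  rcases hI with hI | ⟨hI, hP, hN⟩
  · have h0 : 0 < 2 * I.m := by omega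
    have h : ∀ u < 2 * I.m, w u + w 0 = 0 := fun u hu =>
      hw u hu 0 h0 (by rw [hI u hu, hI 0 h0]; rfl)
    -- Every weight equals `-w 0`, and taking `u = 0` gives `w 0 + w 0 = 0`; the number of terms is
    -- even.
    rw [Finset.sum_congr rfl fun u hu => eq_neg_of_add_eq_zero_left (h u (mem_range.1 hu)),
      sum_const, card_range, mul_comm, mul_nsmul, two_nsmul, ← nsmul_add,
      ← neg_add, h 0 h0]
    simp
  · obtain ⟨p, hp⟩ := card_pos.1 (hP.symm ▸ hm)
    obtain ⟨n, hn⟩ := card_pos.1 (hN.symm ▸ hm)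
    have h : ∀ u ∈ (range (2 * I.m)).filter (fun i => (I.req i).sgn = 1),
        ∀ v ∈ (range (2 * I.m)).filter (fun i => (I.req i).sgn = -1), w u + w v = 0 := by
      intro u hu v hv
      simp only [mem_filter, mem_range] at hu hv
      exact hw u hu.1 v hv.1 (by rw [hu.2, hv.2]; rfl)
    have hneg : (range (2 * I.m)).filter (fun i => ¬(I.req i).sgn = 1) =
        (range (2 * I.m)).filter (fun i => (I.req i).sgn = -1) := by
      refine filter_congr fun i hi => ?_
      rcases hI i (mem_range.1 hi) with h1 | h1 <;> rw [h1] <;> decide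
    rw [← sum_filter_add_sum_filter_not _ (fun i => (I.req i).sgn = 1), hneg,
      Finset.sum_congr rfl fun u hu => eq_neg_of_add_eq_zero_left (h u hu n hn),
      Finset.sum_congr rfl fun v hv => eq_neg_of_add_eq_zero_right (h p hp v hv),
      sum_const, sum_const, hP, hN, ← nsmul_add, ← neg_add, add_comm, h p hp n hn]
    simp

/-! ### Balance of a set of requests against the edges leaving it. -/

open scoped Classical in
/-- The endpoints in `A` of the edges of `M` that leave `A`. -/
noncomputable def crossing (M : Finset MatchEdge) (A : Finset ℕ) : Finset ℕ :=
  A.filter fun u => ∃ e ∈ M, (e.fst = u ∨ e.snd = u) ∧ Separates e.fst e.snd A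

-- An edge that leaves `A` has just one endpoint in `A`, so sending it to that endpoint covers
-- `crossing M A`.
open scoped Classical in
lemma card_crossing_le (M : Finset MatchEdge) (A : Finset ℕ) :
    #(crossing M A) ≤ #(M.filter fun e => Separates e.fst e.snd A) := by
  refine (card_le_card fun u hu => ?_).trans
    (card_image_le (f := fun e : MatchEdge => if e.fst ∈ A then e.fst else e.snd))
  obtain ⟨huA, e, he, heu, hsep⟩ := mem_filter.1 hu
  refine mem_image.2 ⟨e, mem_filter.2 ⟨he, hsep⟩, ?_⟩
  unfold Separates at hsep
  rcases heu with rfl | rfl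
  · simp [huA]
  · have : e.fst ∉ A := by tauto
    simp [this]

lemma Input.Feasible.unique (hM : I.Feasible M) : ∀ e ∈ M, ∀ e' ∈ M, ∀ u,
    (e.fst = u ∨ e.snd = u) → (e'.fst = u ∨ e'.snd = u) → e = e' := by
  intro e he e' he' u hu hu'
  have hlt : u < 2 * I.m := by
    rcases hu with rfl | rfl
    exacts [(hM.1 e he).1, (hM.1 e he).2.1]
  exact (hM.2 u hlt).unique ⟨he, hu⟩ ⟨he', hu'⟩

/-- Requests of `A` whose partner in `M` also lies in `A` cancel. -/
lemma Input.Feasible.sum_crossing (hM : I.Feasible M) {A : Finset ℕ} (hA : A ⊆ range (2 * I.m))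
    {G : Type*} [AddCommGroup G] {w : ℕ → G}
    (hw : ∀ u < 2 * I.m, ∀ v < 2 * I.m, (I.req u).sgn = -(I.req v).sgn → w u + w v = 0) :
    ∑ u ∈ A, w u = ∑ u ∈ crossing M A, w u := by
  classical
  rw [← sum_sdiff (show crossing M A ⊆ A from filter_subset _ _), add_eq_right]
  have hB : ∀ u, u ∈ A \ crossing M A ↔
      u ∈ A ∧ ∀ e ∈ M, (e.fst = u ∨ e.snd = u) → ¬Separates e.fst e.snd A := by
    intro u
    simp only [crossing, mem_sdiff, mem_filter, not_and, not_exists]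
    exact and_congr_right fun hu => ⟨fun h => h hu, fun h _ => h⟩
  refine sum_eq_zero_of_matched (M := M) (fun e he => ?_) (fun e he => (hM.1 e he).2.2.1) hM.unique
    fun u hu => ?_
  · obtain ⟨h1, h2, -, h3, -⟩ := hM.1 e he
    exact hw _ h1 _ h2 h3
  · obtain ⟨huA, hu⟩ := (hB u).1 hu
    obtain ⟨e, ⟨he, heu⟩, -⟩ := hM.2 u (mem_range.1 (hA huA))
    have hsep := hu e he heu
    have key : ∀ v, (e.fst = v ∨ e.snd = v) → v ∈ A → v ∈ A \ crossing M A := by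
      intro v hv hvA
      refine (hB v).2 ⟨hvA, fun e' he' hv' => ?_⟩
      rwa [hM.unique e' he' e he v hv' hv]
    unfold Separates at hsep
    refine ⟨e, he, ?_⟩
    rcases heu with rfl | rfl
    · exact Or.inl ⟨rfl, key _ (Or.inr rfl) (by tauto)⟩
    · exact Or.inr ⟨rfl, key _ (Or.inl rfl) (by tauto)⟩

variable [MetricSpace X]

namespace Invariant

open scoped Classical in
lemma sum_free (h : Invariant I s) {A : Finset ℕ} (hA : A ⊆ range s.num)
    (hcl : ∀ e ∈ s.matching, e.fst ∈ A ↔ e.snd ∈ A)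
    {G : Type*} [AddCommGroup G] {w : ℕ → G}
    (hw : ∀ u < 2 * I.m, ∀ v < 2 * I.m, (I.req u).sgn = -(I.req v).sgn → w u + w v = 0) :
    ∑ u ∈ A, w u = ∑ u ∈ A.filter s.IsFree, w u := by
  rw [← sum_filter_add_sum_filter_not A s.IsFree, add_eq_left]
  refine sum_eq_zero_of_matched (M := s.matching) (fun e he => ?_)
    (fun e he => (h.matched e he).2.2.1) h.matched_unique fun u hu => ?_
  · obtain ⟨h1, h2, -, h3, -⟩ := h.matched e he
    exact hw _ (h1.trans_le h.num_le) _ (h2.trans_le h.num_le) h3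
  · obtain ⟨huA, hu⟩ := mem_filter.1 hu
    have hex : ∃ e ∈ s.matching, e.fst = u ∨ e.snd = u := by
      by_contra! hn
      exact hu ⟨mem_range.1 (hA huA), hn⟩
    obtain ⟨e, he, heu⟩ := hex
    have hc := hcl e he
    refine ⟨e, he, ?_⟩
    rcases heu with rfl | rfl
    · exact Or.inl ⟨rfl, mem_filter.2 ⟨hc.1 huA, fun hn => (hn.2 e he).2 rfl⟩⟩
    · exact Or.inr ⟨rfl, mem_filter.2 ⟨hc.2 huA, fun hn => (hn.2 e he).1 rfl⟩⟩

-- The free requests of `S` and the endpoints of `M`-edges leaving `S` both have the balance of `S`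
-- itself: the former because GD matches within active sets, the latter by `sum_crossing`. As no two
-- free requests of `S` are matchable, `card_le_card_of_balance` applies.
open scoped Classical in
lemma card_free_le (h : Invariant I s) (hI : I.IsMPMD ∨ I.IsMBPMD)
    (hn : ¬∃ u v, s.IsMatchable u v) (hM : I.Feasible M) {S : Finset ℕ} (hS : s.IsGrowing S) :
    #(S.filter s.IsFree) ≤ #(M.filter fun e => Separates e.fst e.snd S) := by
  have hSn : S ⊆ range s.num := fun u hu => mem_range.2 (h.active_eq hS hu).1
  have hS2 : S ⊆ range (2 * I.m) := hSn.trans (range_subset_range.2 h.num_le)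
  refine (card_le_card_of_balance hI ((filter_subset _ _).trans hS2)
    (C := crossing M S) ?_ fun w hw => ?_).trans
    (card_crossing_le M S)
  · intro u hu v hv hne hs
    obtain ⟨hu, hu'⟩ := mem_filter.1 hu
    obtain ⟨hv, hv'⟩ := mem_filter.1 hv
    exact hn ⟨u, v, h.isEdge_iff.2 ⟨hu'.1, hv'.1, hne, hs⟩,
      (h.active_eq hS hu).2.trans (h.active_eq hS hv).2.symm, hu', hv'⟩
  · rw [← hM.sum_crossing hS2 hw, h.sum_free hSn _ hw]
    intro e he
    obtain ⟨h1, h2, -, -, -, -, h3⟩ := h.matched e he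
    obtain ⟨⟨a, ha, rfl⟩, -⟩ := hS
    rw [h.mem_active a ha, h.mem_active a ha, h3]
    tauto

end Invariant

/-! ### The dual bound -/

/-- The total load of the edges of `M`. -/
noncomputable def dualValue (s : State) (M : Finset MatchEdge) : ℝ :=
  ∑ e ∈ M, s.ysum (Separates e.fst e.snd)

/-- The waiting cost incurred so far. -/
noncomputable def waiting (I : Input X) (s : State) : ℝ :=
  ∑ e ∈ s.matching, ((e.time - (I.req e.fst).atime) + (e.time - (I.req e.snd).atime)) +
    ∑ u ∈ s.free, (s.clock - (I.req u).atime)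

/-- The waiting cost and the total value of the dual variables are charged to the solution `M`. -/
def Charged (I : Input X) (M : Finset MatchEdge) (s : State) : Prop :=
  waiting I s ≤ dualValue s M ∧ s.ysum (fun _ => True) ≤ dualValue s M

open scoped Classical in
lemma sum_growth_separates (s : State) (M : Finset MatchEdge) :
    ∑ e ∈ M, s.growth (Separates e.fst e.snd) =
      ∑ S ∈ s.growing, #(M.filter fun e => Separates e.fst e.snd S) := by
  simp only [State.growth, card_filter]
  exact Finset.sum_comm

/-- Only waiting changes the quantities compared. Matching moves a waiting cost from the free to the
matched requests, and an arriving request has waited for time 0. During a wait all quantities grow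
linearly, so rates are compared. -/
lemma Charged.step (h : Invariant I s) (hI : I.IsMPMD ∨ I.IsMBPMD) (hM : I.Feasible M)
    (hc : Charged I M s) {ρ : TieBreaking} {s' : State} (hs : Step ρ I s s') :
    Charged I M s' := by
  classical
  cases hs with
  | pair hm =>
    refine ⟨?_, hc.2⟩
    refine le_of_eq_of_le ?_ hc.1
    obtain ⟨⟨-, -, hne, -⟩, -, hu, hv⟩ := ρ.pick_spec s hm
    generalize (ρ.pick s).1 = u at *
    generalize (ρ.pick s).2 = v at *
    have hfree : (s.pair u v).free = (s.free.erase u).erase v := by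
      ext w
      simp only [State.mem_free, mem_erase, State.IsFree, State.pair, forall_mem_insert]
      tauto
    have hnew : (⟨u, v, s.clock⟩ : MatchEdge) ∉ s.matching := fun he => (hu.2 _ he).1 rfl
    have h1 := Finset.add_sum_erase s.free (fun w => s.clock - (I.req w).atime)
      (State.mem_free.2 hu)
    have h2 := Finset.add_sum_erase (s.free.erase u) (fun w => s.clock - (I.req w).atime)
      (mem_erase.2 ⟨hne.symm, State.mem_free.2 hv⟩)
    unfold waiting
    rw [hfree, ← h1, ← h2]
    simp only [State.pair]
    rw [sum_insert hnew]
    ring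
  | arrive _ hp _ =>
    have hd : dualValue (s.arrive (I.arrival s.num)) M = dualValue s M := by
      simp only [dualValue, State.ysum_arrive]
    refine ⟨?_, by rw [hd, State.ysum_arrive]; exact hc.2⟩
    rw [hd]
    refine le_of_eq_of_le ?_ hc.1
    have hfree : (s.arrive (I.arrival s.num)).free = insert s.num s.free := by
      ext w
      simp only [State.mem_free, mem_insert, State.IsFree, State.arrive]
      constructor
      · rintro ⟨h1, h2⟩
        rcases Nat.lt_succ_iff_lt_or_eq.1 h1 with h1 | h1
        exacts [Or.inr ⟨h1, h2⟩, Or.inl h1]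
      · rintro (rfl | ⟨h1, h2⟩)
        · exact ⟨Nat.lt_succ_self _, fun e he =>
            ⟨(h.matched e he).1.ne, (h.matched e he).2.1.ne⟩⟩
        · exact ⟨Nat.lt_succ_of_lt h1, h2⟩
    have hnew : s.num ∉ s.free := fun hf => lt_irrefl _ (State.mem_free.1 hf).1
    unfold waiting
    rw [hfree, sum_insert hnew]
    simp only [State.arrive]
    rw [hp.2, sub_self, zero_add]
  | merge => exact hc
  | wait δ hn hδ _ _ =>
    have hd : dualValue (s.grow δ) M = dualValue s M +
        δ * ((∑ S ∈ s.growing, #(M.filter fun e => Separates e.fst e.snd S) : ℕ) : ℝ) := by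
      rw [← sum_growth_separates]
      simp only [dualValue, State.ysum_grow, sum_add_distrib, mul_sum, Nat.cast_sum]
    have hw : waiting I (s.grow δ) = waiting I s + δ * #s.free := by
      have : ∑ u ∈ s.free, (s.clock + δ - (I.req u).atime) =
          ∑ u ∈ s.free, (s.clock - (I.req u).atime) + δ * #s.free := by
        rw [mul_comm, ← nsmul_eq_mul, ← sum_const, ← sum_add_distrib]
        exact Finset.sum_congr rfl fun _ _ => by ring
      change _ + ∑ u ∈ s.free, (s.clock + δ - (I.req u).atime) = _
      rw [this, ← add_assoc]
      rfl
    have hbound : ∀ S ∈ s.growing,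
        #(S.filter s.IsFree) ≤ #(M.filter fun e => Separates e.fst e.snd S) :=
      fun S hS => h.card_free_le hI hn hM (h.mem_growing.1 hS)
    -- The waiting cost grows at rate `#s.free`; each free request lies in exactly one growing set.
    have h1 : #s.free ≤ ∑ S ∈ s.growing, #(M.filter fun e => Separates e.fst e.snd S) := by
      rw [card_eq_sum_card_fiberwise (f := s.active) (t := s.growing)
        fun u hu => h.mem_growing.2 (h.isGrowing_active (State.mem_free.1 hu))]
      refine Finset.sum_le_sum fun S hS => (card_le_card fun u hu => ?_).trans (hbound S hS)
      obtain ⟨hu', rfl⟩ := mem_filter.1 hu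
      replace hu := State.mem_free.1 hu'
      exact mem_filter.2 ⟨h.mem_self hu.1, hu⟩
    -- The total dual sum grows at a rate equal to the number of growing sets, each of which has a
    -- free request.
    have h2 : s.growth (fun _ => True) ≤
        ∑ S ∈ s.growing, #(M.filter fun e => Separates e.fst e.snd S) := by
      refine (s.growth_le_card _).trans ?_
      rw [card_eq_sum_ones]
      refine Finset.sum_le_sum fun S hS => le_trans ?_ (hbound S hS)
      obtain ⟨-, u, hu, hu'⟩ := h.mem_growing.1 hS
      exact card_pos.2 ⟨u, mem_filter.2 ⟨hu, hu'⟩⟩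
    have h3 := mul_le_mul_of_nonneg_left (Nat.cast_le (α := ℝ).2 h1) hδ.le
    have h4 := mul_le_mul_of_nonneg_left (Nat.cast_le (α := ℝ).2 h2) hδ.le
    refine ⟨?_, ?_⟩
    · rw [hd, hw]
      linarith [hc.1]
    · rw [hd, State.ysum_grow]
      linarith [hc.2]

lemma Charged.reflTransGen (h : Invariant I s) (hI : I.IsMPMD ∨ I.IsMBPMD) (hM : I.Feasible M)
    (hc : Charged I M s) {ρ : TieBreaking} {s' : State}
    (hs : Relation.ReflTransGen (Step ρ I) s s') : Charged I M s' := by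
  induction hs with
  | refl => exact hc
  | tail h1 h2 ih => exact ih.step (h.reflTransGen h1) hI hM h2

lemma Charged.init {X : Type u} (I : Input X) (M : Finset MatchEdge) (t₀ : ℝ) :
    Charged I M (State.init t₀) := by
  have h0 : ∀ P, (State.init t₀).ysum P = 0 := fun P => State.ysum_eq_zero fun _ _ => rfl
  have hf : (State.init t₀).free = ∅ := rfl
  simp only [Charged, waiting, dualValue, h0, hf]
  simp [State.init]

/-- Weak duality: the two waiting times of an edge of `M` add up to at least the difference of its
arrival times. All requests must have arrived for the constraints of all edges of `M` to be
available. -/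
lemma Invariant.dualValue_le_cost (h : Invariant I s) (hnum : s.num = 2 * I.m)
    (hM : I.Feasible M) : dualValue s M ≤ I.cost M := by
  refine Finset.sum_le_sum fun e he => ?_
  obtain ⟨h1, h2, h3, h4, h5, h6⟩ := hM.1 e he
  refine (h.load_le _ (hnum ▸ h1) _ (hnum ▸ h2) h3 h4).trans ?_
  unfold Input.edgeCost
  have : |(I.req e.fst).atime - (I.req e.snd).atime| ≤
      e.time - (I.req e.fst).atime + (e.time - (I.req e.snd).atime) := by
    rw [abs_le]; constructor <;> linarith
  linarith

lemma Input.Feasible.card_le {X : Type u} {I : Input X} (hM : I.Feasible M) : #M ≤ I.m := by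
  classical
  have := Finset.card_mul_le_card_mul (s := M) (t := range (2 * I.m)) (m := 2) (n := 1)
    (fun e u => e.fst = u ∨ e.snd = u) (fun e he => ?_) fun u _ => ?_
  · rw [card_range] at this
    omega
  · obtain ⟨h1, h2, h3, -⟩ := hM.1 e he
    refine (card_pair h3).symm.trans_le (card_le_card fun u hu => ?_)
    rw [mem_insert, mem_singleton] at hu
    rw [mem_bipartiteAbove, mem_range]
    rcases hu with rfl | rfl
    exacts [⟨h1, Or.inl rfl⟩, ⟨h2, Or.inr rfl⟩]
  · refine card_le_one.2 fun e he e' he' => ?_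
    rw [mem_bipartiteBelow] at he he'
    exact hM.unique e he.1 e' he'.1 u he.2 he'.2

/-! ### Termination -/

/-- The rules exclude each other: a wait requires that there is no event at `ε = 0`, and its length
is the first moment with an event. -/
lemma Step.det {ρ : TieBreaking} {a b : State} (ha : Step ρ I s a) (hb : Step ρ I s b) :
    a = b := by
  have h0 : ∀ δ, (∀ ε, 0 ≤ ε → ε < δ → ¬HasEvent I (s.grow ε)) → 0 < δ → ¬HasEvent I s := by
    intro δ h hδ
    simpa only [State.grow_zero] using h 0 le_rfl hδ
  cases ha with
  | pair h =>
    cases hb with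
    | pair => rfl
    | arrive h' => exact absurd h h'
    | merge h' => exact absurd h h'
    | wait _ h' => exact absurd h h'
  | arrive h1 h2 h3 =>
    cases hb with
    | pair h' => exact absurd h' h1
    | arrive => rfl
    | merge _ h4 h5 => exact absurd (h3 h4) (h5 h2)
    | wait δ _ h4 h5 => exact absurd (Or.inl h2) (h0 δ h5 h4)
  | merge h1 h2 h3 =>
    cases hb with
    | pair h' => exact absurd h' h1
    | arrive _ h4 h5 => exact absurd (h5 h2) (h3 h4)
    | merge => rfl
    | wait δ _ h4 h5 => exact absurd (Or.inr h2) (h0 δ h5 h4)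
  | wait δ h1 h2 h3 h4 =>
    cases hb with
    | pair h' => exact absurd h' h1
    | arrive _ h5 => exact absurd (Or.inl h5) (h0 δ h3 h2)
    | merge _ h5 => exact absurd (Or.inr h5) (h0 δ h3 h2)
    | wait δ' _ h5 h6 h7 =>
      rcases lt_trichotomy δ δ' with hlt | rfl | hlt
      · exact absurd h4 (h6 δ h2.le hlt)
      · rfl
      · exact absurd h7 (h3 δ' h5.le hlt)

lemma reflTransGen_of_halted {ρ : TieBreaking} {p q t : State}
    (ht : ∀ t', ¬Step ρ I t t') (hpt : Relation.ReflTransGen (Step ρ I) p t)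
    (hpq : Step ρ I p q) : Relation.ReflTransGen (Step ρ I) q t := by
  rcases hpt.cases_head with rfl | ⟨q', h1, h2⟩
  · exact absurd hpq (ht q)
  · rwa [hpq.det h1]

lemma HaltsAt.unique {ρ : TieBreaking} {t₀ : ℝ} {a b : State} (ha : HaltsAt ρ I t₀ a)
    (hb : HaltsAt ρ I t₀ b) : a = b := by
  obtain ⟨ha, ha'⟩ := ha
  obtain ⟨hb, hb'⟩ := hb
  generalize State.init t₀ = p at ha hb
  induction ha using Relation.ReflTransGen.head_induction_on with
  | refl =>
    rcases hb.cases_head with h | ⟨q, h1, -⟩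
    · exact h
    · exact absurd h1 (ha' q)
  | head h1 _ ih => exact ih (reflTransGen_of_halted hb' hb h1)

open scoped Classical in
/-- A bound on the number of steps that are still to come. -/
noncomputable def rank (I : Input X) (s : State) : ℕ :=
  2 * (#((range (2 * I.m) ×ˢ range (2 * I.m)).filter fun p =>
      ¬(p.1 < s.num ∧ p.2 < s.num ∧ s.active p.1 = s.active p.2)) +
    #((range (2 * I.m)).filter fun u => ∀ e ∈ s.matching, e.fst ≠ u ∧ e.snd ≠ u)) +
  if HasEvent I s then 0 else 1

/-- Arrivals and merges put a new pair into a common active set (for an arrival, the new request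
with itself), and matching uses up unmatched requests. The factor 2 outweighs the event flag, which
may rise by 1 in these steps; a wait changes only this flag, from 1 to 0. -/
lemma Invariant.rank_lt (h : Invariant I s) {ρ : TieBreaking} {s' : State}
    (hs : Step ρ I s s') : rank I s' < rank I s := by
  classical
  have hb : ∀ t : State, (if HasEvent I t then 0 else 1) ≤ 1 := fun t => by split_ifs <;> simp
  cases hs with
  | pair hm =>
    obtain ⟨-, -, hu, hv⟩ := ρ.pick_spec s hm
    generalize (ρ.pick s).1 = u at *
    generalize (ρ.pick s).2 = v at *
    have hlt : #((range (2 * I.m)).filter fun w =>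
        ∀ e ∈ (s.pair u v).matching, e.fst ≠ w ∧ e.snd ≠ w) <
        #((range (2 * I.m)).filter fun w => ∀ e ∈ s.matching, e.fst ≠ w ∧ e.snd ≠ w) := by
      refine card_lt_card ((ssubset_iff_of_subset ?_).2 ⟨u, ?_, ?_⟩)
      · exact monotone_filter_right _ fun w _ hw e he => hw e (mem_insert_of_mem he)
      · exact mem_filter.2 ⟨mem_range.2 (hu.1.trans_le h.num_le), hu.2⟩
      · exact fun hn => ((mem_filter.1 hn).2 _ (mem_insert_self _ _)).1 rfl
    have := hb (s.pair u v)
    have h3 : #((range (2 * I.m) ×ˢ range (2 * I.m)).filter fun p =>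
        ¬(p.1 < (s.pair u v).num ∧ p.2 < (s.pair u v).num ∧
          (s.pair u v).active p.1 = (s.pair u v).active p.2)) =
      #((range (2 * I.m) ×ˢ range (2 * I.m)).filter fun p =>
        ¬(p.1 < s.num ∧ p.2 < s.num ∧ s.active p.1 = s.active p.2)) := rfl
    unfold rank
    omega
  | arrive _ hp _ =>
    set t := s.arrive (I.arrival s.num) with ht
    have hlt : #((range (2 * I.m) ×ˢ range (2 * I.m)).filter fun p =>
        ¬(p.1 < t.num ∧ p.2 < t.num ∧ t.active p.1 = t.active p.2)) <
      #((range (2 * I.m) ×ˢ range (2 * I.m)).filter fun p =>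
        ¬(p.1 < s.num ∧ p.2 < s.num ∧ s.active p.1 = s.active p.2)) := by
      refine card_lt_card ((ssubset_iff_of_subset ?_).2 ⟨(s.num, s.num), ?_, ?_⟩)
      · refine monotone_filter_right _ fun p _ hp' hn => hp' ?_
        obtain ⟨h1, h2, h3⟩ := hn
        exact ⟨Nat.lt_succ_of_lt h1, Nat.lt_succ_of_lt h2, by
          simpa [ht, State.arrive, h1.ne, h2.ne] using h3⟩
      · simp [hp.1]
      · simp [ht, State.arrive]
    have := hb t
    have h3 : #((range (2 * I.m)).filter fun w => ∀ e ∈ t.matching, e.fst ≠ w ∧ e.snd ≠ w) =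
        #((range (2 * I.m)).filter fun w => ∀ e ∈ s.matching, e.fst ≠ w ∧ e.snd ≠ w) := rfl
    unfold rank
    omega
  | merge _ hm _ =>
    obtain ⟨hedge, hact, -⟩ := ρ.edge_spec s hm
    generalize (ρ.edge s).1 = a at *
    generalize (ρ.edge s).2 = b at *
    obtain ⟨ha, hb', -⟩ := h.isEdge_iff.1 hedge
    have hlt : #((range (2 * I.m) ×ˢ range (2 * I.m)).filter fun p =>
        ¬(p.1 < (s.merge a b).num ∧ p.2 < (s.merge a b).num ∧
          (s.merge a b).active p.1 = (s.merge a b).active p.2)) <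
      #((range (2 * I.m) ×ˢ range (2 * I.m)).filter fun p =>
        ¬(p.1 < s.num ∧ p.2 < s.num ∧ s.active p.1 = s.active p.2)) := by
      refine card_lt_card ((ssubset_iff_of_subset ?_).2 ⟨(a, b), ?_, ?_⟩)
      · refine monotone_filter_right _ fun p _ hp' hn => hp' ?_
        obtain ⟨h1, h2, h3⟩ := hn
        refine ⟨h1, h2, ?_⟩
        have : p.1 ∈ s.active a ∪ s.active b ↔ p.2 ∈ s.active a ∪ s.active b := by
          simp only [mem_union, h.mem_active a ha, h.mem_active b hb', h1, h2, h3]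
        simp only [State.merge, this, h3]
      · simp only [mem_filter, mem_product, mem_range]
        exact ⟨⟨ha.trans_le h.num_le, hb'.trans_le h.num_le⟩, fun hn => hact hn.2.2⟩
      · intro hn
        refine (mem_filter.1 hn).2 ⟨ha, hb', ?_⟩
        simp [State.merge, h.mem_self ha, h.mem_self hb']
    have := hb (s.merge a b)
    have h3 : #((range (2 * I.m)).filter fun w =>
        ∀ e ∈ (s.merge a b).matching, e.fst ≠ w ∧ e.snd ≠ w) =
        #((range (2 * I.m)).filter fun w => ∀ e ∈ s.matching, e.fst ≠ w ∧ e.snd ≠ w) := rfl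
    unfold rank
    omega
  | wait δ _ hδ hn he =>
    have h0 : ¬HasEvent I s := by simpa only [State.grow_zero] using hn 0 le_rfl hδ
    unfold rank
    rw [if_pos he, if_neg h0]
    exact Nat.lt_succ_self _

lemma Invariant.exists_halted (h : Invariant I s) (ρ : TieBreaking) :
    ∃ t, Relation.ReflTransGen (Step ρ I) s t ∧ ∀ t', ¬Step ρ I t t' := by
  induction hn : rank I s using Nat.strong_induction_on generalizing s with
  | _ n ih =>
    by_cases hs : ∃ s', Step ρ I s s'
    · obtain ⟨s', hs'⟩ := hs
      obtain ⟨t, ht, ht'⟩ := ih _ (hn ▸ h.rank_lt hs') (h.step hs') rfl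
      exact ⟨t, ht.head hs', ht'⟩
    · exact ⟨s, .refl, not_exists.1 hs⟩

/-! ### What halting implies. -/

lemma isClosed_hasEvent {X : Type u} (I : Input X) (s : State) :
    IsClosed {ε | HasEvent I (s.grow ε)} := by
  have hset : {ε | HasEvent I (s.grow ε)} =
      {ε | s.num < 2 * I.m ∧ (I.req s.num).atime = s.clock + ε} ∪
      ⋃ p ∈ range s.num ×ˢ range s.num, {ε | (s.IsEdge p.1 p.2 ∧ s.active p.1 ≠ s.active p.2) ∧
        s.ysum (Separates p.1 p.2) + ε * s.growth (Separates p.1 p.2) =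
          s.edgeCost p.1 p.2} := by
    ext ε
    simp only [Set.mem_ofPred_eq, Set.mem_union, Set.mem_iUnion]
    refine or_congr Iff.rfl ⟨?_, ?_⟩
    · rintro ⟨u, v, h1, h2, h3⟩
      refine ⟨(u, v), mem_product.2 ⟨mem_range.2 h1.1, mem_range.2 h1.2.1⟩, ⟨h1, h2⟩, ?_⟩
      rw [← State.ysum_grow, ← State.load_eq_ysum]
      exact h3
    · rintro ⟨p, -, ⟨h1, h2⟩, h3⟩
      refine ⟨p.1, p.2, h1, h2, ?_⟩
      rw [State.load_eq_ysum, State.ysum_grow]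
      exact h3
  rw [hset]
  refine IsClosed.union ?_ (isClosed_biUnion_finset fun p _ => ?_)
  · exact isClosed_const.and (isClosed_eq (by fun_prop) (by fun_prop))
  · exact isClosed_const.and (isClosed_eq (by fun_prop) (by fun_prop))

/-- If there were a later event, closedness of the set of event times would give a first one, and
waiting for it would be a step. -/
lemma no_event_of_halted {ρ : TieBreaking} (hs : ∀ s', ¬Step ρ I s s') :
    (¬∃ u v, s.IsMatchable u v) ∧ ∀ ε, 0 ≤ ε → ¬HasEvent I (s.grow ε) := by
  have hm : ¬∃ u v, s.IsMatchable u v := fun h => hs _ (Step.pair s h)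
  refine ⟨hm, fun ε hε he => ?_⟩
  have h0 : ¬HasEvent I s := by
    intro he
    by_cases ht : ∃ u v, s.IsTight u v
    · by_cases hp : Pending I s ∧ ρ.arrivalFirst s
      · exact hs _ (Step.arrive s hm hp.1 fun _ => hp.2)
      · exact hs _ (Step.merge s hm ht fun h1 h2 => hp ⟨h1, h2⟩)
    · exact hs _ (Step.arrive s hm (he.resolve_right ht) fun h => absurd h ht)
  set E := {ε | HasEvent I (s.grow ε)} ∩ Set.Ici (0 : ℝ)
  have hE : IsClosed E := (isClosed_hasEvent I s).inter isClosed_Ici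
  have hbdd : BddBelow E := ⟨0, fun x hx => hx.2⟩
  have hmem := hE.csInf_mem ⟨ε, he, hε⟩ hbdd
  refine hs _ (Step.wait s (sInf E) hm (lt_of_le_of_ne hmem.2 fun h => h0 ?_) ?_ hmem.1)
  · have := hmem.1
    rwa [← h, Set.mem_ofPred_eq, State.grow_zero] at this
  · exact fun ε' h1 h2 h3 => absurd (csInf_le hbdd ⟨h3, h1⟩) (not_le.2 h2)

/-- Two compatible free requests would lie in different active sets, both growing, so their
constraint would become tight at some future moment. Hence the free requests are pairwise
incompatible, while their balance is that of the whole input, namely 0; comparison with `C = ∅`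
leaves none. -/
lemma Invariant.num_eq_and_free_eq_empty (h : Invariant I s) (hI : I.IsMPMD ∨ I.IsMBPMD)
    {ρ : TieBreaking} (hs : ∀ s', ¬Step ρ I s s') : s.num = 2 * I.m ∧ s.free = ∅ := by
  classical
  obtain ⟨hm, hne⟩ := no_event_of_halted hs
  have hnum : s.num = 2 * I.m := by
    refine le_antisymm h.num_le (not_lt.1 fun hlt => ?_)
    refine hne ((I.req s.num).atime - s.clock) (sub_nonneg.2 (h.le_atime hlt))
      (Or.inl ⟨hlt, ?_⟩)
    simp [State.grow]
  refine ⟨hnum, ?_⟩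
  have hfilter : (range s.num).filter s.IsFree = s.free := rfl
  rw [← card_eq_zero, ← Nat.le_zero, ← card_empty (α := ℕ)]
  refine card_le_card_of_balance hI (hnum ▸ filter_subset _ _) ?_
    fun w hw => ?_
  · intro u hu v hv huv hsgn
    rw [State.mem_free] at hu hv
    have hedge := h.isEdge_iff.2 ⟨hu.1, hv.1, huv, hsgn⟩
    have hact : s.active u ≠ s.active v := fun he => hm ⟨u, v, hedge, he, hu, hv⟩
    have hpos : 0 < s.growth (Separates u v) := by
      refine card_pos.2 ⟨s.active u, mem_filter.2 ⟨h.mem_growing.2 (h.isGrowing_active hu), ?_⟩⟩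
      have h1 := h.mem_self hu.1
      have h2 : v ∉ s.active u := fun hv' => hact ((h.mem_active u hu.1 v).1 hv').2.symm
      unfold Separates
      tauto
    have hpos' : (0 : ℝ) < s.growth (Separates u v) := by exact_mod_cast hpos
    have hle := h.load_le u hu.1 v hv.1 huv hsgn
    refine hne ((I.edgeCost u v - s.ysum (Separates u v)) / s.growth (Separates u v))
      (div_nonneg (sub_nonneg.2 hle) hpos'.le) (Or.inr ⟨u, v, hedge, hact, ?_⟩)
    rw [State.load_eq_ysum, State.ysum_grow, div_mul_cancel₀ _ hpos'.ne']
    change _ = s.edgeCost u v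
    rw [h.edgeCost_eq hu.1 hv.1]
    ring
  · rw [← hfilter, ← h.sum_free (subset_refl _) _ hw, hnum, sum_empty]
    · exact sum_range_eq_zero hI hw
    · intro e he
      obtain ⟨h1, h2, -⟩ := h.matched e he
      simp [h1, h2]

/-! ### The final matching and its cost. -/

lemma Invariant.feasible (h : Invariant I s) (hnum : s.num = 2 * I.m) (hfree : s.free = ∅) :
    I.Feasible s.matching := by
  constructor
  · intro e he
    obtain ⟨h1, h2, h3, h4, h5, h6, -⟩ := h.matched e he
    exact ⟨hnum ▸ h1, hnum ▸ h2, h3, h4, h5, h6⟩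
  · intro i hi
    have hni : ¬s.IsFree i := fun hf => by simpa [hfree] using State.mem_free.2 hf
    have hex : ∃ e ∈ s.matching, e.fst = i ∨ e.snd = i := by
      by_contra! hn
      exact hni ⟨hnum ▸ hi, hn⟩
    obtain ⟨e, he, hei⟩ := hex
    exact ⟨e, ⟨he, hei⟩, fun e' he' => h.matched_unique e' he'.1 e he i he'.2 hei⟩

lemma Invariant.cost_le (h : Invariant I s) (hnum : s.num = 2 * I.m) (hfree : s.free = ∅)
    (hM : I.Feasible M) (hc : Charged I M s) :
    I.cost s.matching ≤ (2 * (I.m : ℝ) + 1) * I.cost M := by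
  have hcost : I.cost s.matching =
      ∑ e ∈ s.matching, dist (I.req e.fst).pos (I.req e.snd).pos + waiting I s := by
    unfold waiting Input.cost
    rw [hfree, sum_empty, add_zero, ← sum_add_distrib]
    exact Finset.sum_congr rfl fun _ _ => by ring
  have hdist : ∑ e ∈ s.matching, dist (I.req e.fst).pos (I.req e.snd).pos ≤
      #s.matching * (2 * s.ysum fun _ => True) := by
    rw [← nsmul_eq_mul, ← sum_const]
    exact Finset.sum_le_sum fun e he => h.matched_dist e he
  have hcard : (#s.matching : ℝ) ≤ I.m := by exact_mod_cast (h.feasible hnum hfree).card_le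
  have h0 := State.ysum_nonneg h.y_nonneg fun _ => True
  have hle := h.dualValue_le_cost hnum hM
  calc I.cost s.matching
      ≤ #s.matching * (2 * s.ysum fun _ => True) + waiting I s := by linarith
    _ ≤ I.m * (2 * I.cost M) + I.cost M := by
        gcongr
        · exact hc.2.trans hle
        · exact hc.1.trans hle
    _ = _ := by ring

/-! ### Online behaviour -/

variable {Y : Type v} [MetricSpace Y] {J : Input Y} {τ : ℝ} {ρ : TieBreaking}

lemma SameUntil.symm (h : SameUntil I J τ) : SameUntil J I τ := by
  obtain ⟨k, h1, h2, h3, h4, h5⟩ := h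
  exact ⟨k, h2, h1, fun i hi => (h3 i hi).symm, h5, h4⟩

lemma SameUntil.pending (h : SameUntil I J τ) (hs : s.clock ≤ τ) (hp : Pending I s) :
    Pending J s ∧ I.arrival s.num = J.arrival s.num := by
  obtain ⟨k, h1, h2, h3, h4, h5⟩ := h
  obtain ⟨hp1, hp2⟩ := hp
  have hk : s.num < k := by
    by_contra! hk
    have := h4 _ hk hp1
    linarith
  have harr := h3 _ hk
  refine ⟨⟨by omega, ?_⟩, harr⟩
  rw [← hp2]
  exact (congrArg Arrival.atime harr).symm

lemma SameUntil.hasEvent (h : SameUntil I J τ) (hs : s.clock ≤ τ) (he : HasEvent I s) :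
    HasEvent J s :=
  he.imp_left fun hp => (h.pending hs hp).1

lemma Step.clock_le {p q : State} (h : Step ρ I p q) : p.clock ≤ q.clock := by
  cases h with
  | wait δ _ hδ => exact le_add_of_nonneg_right hδ.le
  | _ => exact le_rfl

/-- The input enters a step only through arrivals. For a wait or a merge the absence of an arrival
has to be transferred as well, hence the use of `h.symm`. -/
lemma SameUntil.step (h : SameUntil I J τ) {p q : State} (hq : q.clock ≤ τ)
    (hpq : Step ρ I p q) : Step ρ J p q := by
  have hp := hpq.clock_le.trans hq
  cases hpq with
  | pair hm => exact Step.pair p hm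
  | arrive hm hpend hf =>
    obtain ⟨h1, h2⟩ := h.pending hp hpend
    rw [h2]
    exact Step.arrive p hm h1 hf
  | merge hm ht hf => exact Step.merge p hm ht fun hpend => hf (h.symm.pending hp hpend).1
  | wait δ hm hδ hn he =>
    refine Step.wait p δ hm hδ (fun ε h1 h2 h3 => hn ε h1 h2 ?_) (h.hasEvent hq he)
    refine h.symm.hasEvent (le_trans ?_ hq) h3
    exact add_le_add_right h2.le _

lemma Step.mem_matching_iff {p q : State} (h : Step ρ I p q) (hq : τ < q.clock) {e : MatchEdge}
    (he : e.time ≤ τ) : e ∈ p.matching ↔ e ∈ q.matching := by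
  classical
  cases h with
  | pair hm =>
    simp only [State.pair, mem_insert]
    refine ⟨Or.inr, fun h' => h'.resolve_left ?_⟩
    rintro rfl
    exact absurd he (not_le.2 hq)
  | _ => exact Iff.rfl

lemma mem_matching_iff_of_reflTransGen {p q : State}
    (h : Relation.ReflTransGen (Step ρ I) p q) (hp : τ < p.clock) {e : MatchEdge}
    (he : e.time ≤ τ) : τ < q.clock ∧ (e ∈ p.matching ↔ e ∈ q.matching) := by
  induction h with
  | refl => exact ⟨hp, Iff.rfl⟩
  | tail _ h2 ih =>
    have hlt := ih.1.trans_le h2.clock_le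
    exact ⟨hlt, ih.2.trans (h2.mem_matching_iff hlt he)⟩

/-- A state after which nothing happens up to time `τ` has all the edges matched up to then. -/
lemma mem_matching_iff_of_no_step {p q : State} (h : Relation.ReflTransGen (Step ρ I) p q)
    (hp : ∀ p', Step ρ I p p' → τ < p'.clock) {e : MatchEdge} (he : e.time ≤ τ) :
    e ∈ p.matching ↔ e ∈ q.matching := by
  rcases h.cases_head with rfl | ⟨p', h1, h2⟩
  · exact Iff.rfl
  · exact (h1.mem_matching_iff (hp p' h1) he).trans
      (mem_matching_iff_of_reflTransGen h2 (hp p' h1) he).2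

/-- The run on `I` is copied to `J` for as long as its steps end by `τ`. Once the next step on one
input ends after `τ` or does not exist, the same holds on the other input, since an earlier step
would transfer back; edges added later carry times after `τ`. -/
lemma SameUntil.mem_matching_iff (h : SameUntil I J τ) {p a b : State}
    (ha : Relation.ReflTransGen (Step ρ I) p a) (hb : Relation.ReflTransGen (Step ρ J) p b)
    (ha' : ∀ a', ¬Step ρ I a a') (hb' : ∀ b', ¬Step ρ J b b') {e : MatchEdge}
    (he : e.time ≤ τ) : e ∈ a.matching ↔ e ∈ b.matching := by
  induction ha using Relation.ReflTransGen.head_induction_on with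
  | refl =>
    refine mem_matching_iff_of_no_step hb (fun q hq => ?_) he
    by_contra! hle
    exact ha' q (h.symm.step hle hq)
  | @head p c h1 h2 ih =>
    by_cases hc : c.clock ≤ τ
    · exact ih (reflTransGen_of_halted hb' hb (h.step hc h1))
    · rw [not_le] at hc
      have hI : e ∈ p.matching ↔ e ∈ a.matching :=
        mem_matching_iff_of_no_step (h2.head h1) (fun q hq => hq.det h1 ▸ hc) he
      rw [← hI]
      refine mem_matching_iff_of_no_step hb (fun q hq => ?_) he
      by_contra! hle
      exact absurd ((h.symm.step hle hq).det h1 ▸ hle) (not_le.2 hc)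

end MPMD

theorem theorem1 (ρ : MPMD.TieBreaking) :
    -- on every input of either variant, the algorithm produces exactly one outcome, which is a
    -- feasible solution of cost at most `(2 * m + 1)` times the offline optimum
    (∀ (X : Type u) [MetricSpace X] (I : MPMD.Input X) (t₀ : ℝ),
      (I.IsMPMD ∨ I.IsMBPMD) → (∀ i < 2 * I.m, t₀ ≤ (I.req i).atime) →
      ∃ s : MPMD.State, (∀ s', MPMD.HaltsAt ρ I t₀ s' ↔ s' = s) ∧
        I.Feasible s.matching ∧
        I.cost s.matching ≤ (2 * (I.m : ℝ) + 1) * I.opt) ∧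
    -- the algorithm is online: what it matches up to time `τ` depends only on what the requests
    -- that have arrived up to time `τ` reveal, not on the rest of the input or the metric space
    (∀ (X : Type u) [MetricSpace X] (Y : Type v) [MetricSpace Y]
      (I : MPMD.Input X) (J : MPMD.Input Y) (t₀ τ : ℝ) (s s' : MPMD.State),
      MPMD.SameUntil I J τ → MPMD.HaltsAt ρ I t₀ s → MPMD.HaltsAt ρ J t₀ s' →
      ∀ e : MPMD.MatchEdge, e.time ≤ τ → (e ∈ s.matching ↔ e ∈ s'.matching)) := by
  constructor
  · intro X _ I t₀ hI ht
    have hinit := MPMD.Invariant.init ht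
    obtain ⟨s, hs, hs'⟩ := hinit.exists_halted ρ
    have h := hinit.reflTransGen hs
    obtain ⟨hnum, hfree⟩ := h.num_eq_and_free_eq_empty hI hs'
    have hfeas := h.feasible hnum hfree
    refine ⟨s, fun s' => ⟨fun h' => h'.unique ⟨hs, hs'⟩, fun h' => h' ▸ ⟨hs, hs'⟩⟩, hfeas, ?_⟩
    have hpos : (0 : ℝ) < 2 * I.m + 1 := by positivity
    -- After division it suffices to bound the cost of every feasible `M` from below; it need not be
    -- known that the infimum is attained. GD's own solution shows that the set of costs is
    -- nonempty.
    rw [← div_le_iff₀' hpos]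
    refine le_csInf ⟨_, _, hfeas, rfl⟩ ?_
    rintro c ⟨M, hM, rfl⟩
    rw [div_le_iff₀' hpos]
    exact h.cost_le hnum hfree hM
      ((MPMD.Charged.init I M t₀).reflTransGen hinit hI hM hs)
  · intro X _ Y _ I J t₀ τ s s' hIJ hs hs' e he
    exact hIJ.mem_matching_iff hs.1 hs'.1 hs.2 hs'.2 he
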